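/- Let $X \subset \mathbb R^n$ be a regular convex set, i.e. a closed convex set with non-empty interior $X^o$ which contains no line. An (affinely) self-concordant barrier on $X$ with parameter $\nu>0$ is a $C^3$ function $F: X^o \to \mathbb R$ such that $F''(x) \succ 0$ for all $x \in X^o$; $F(x) \to +\infty$ as $x \in X^o$ tends to any point of $\partial X$; and, for all $x \in X^o$, $h \in \mathbb R^n$, $|F'''(x)[h,h,h]| \le 2 (F''(x)[h,h])^{3/2}$ and $|F'(x)[h]| \le \sqrt{\nu}\,(F''(x)[h,h])^{1/2}$. A projectively self-concordant barrier on $X$ with parameter $\gamma \ge 0$ is a $C^3$ function $f: X^o \to \mathbb R$ such that $f''(x) - f'(x)f'(x)^T \succ 0$ for all $x \in X^o$; $f(x) \to +\infty$ as $x \in X^o$ tends to any point of $\partial X$; and, for all $x \in X^o$, $h \in \mathbb R^n$, $|f'''(x)[h,h,h] - 6 f''(x)[h,h] f'(x)[h] + 4 (f'(x)[h])^3| \le 2\gamma\,(f''(x)[h,h] - (f'(x)[h])^2)^{3/2}$. Then: (i) If $f$ is a projectively self-concordant barrier on $X$ with parameter $\gamma$, then $F = \nu f$ is an affinely self-concordant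 barrier on $X$ with parameter $\nu = (\gamma + \sqrt{\gamma^2+4})\sqrt{\frac{\gamma^2}{4}+1}$. (ii) If $F$ is an affinely self-concordant barrier on $X$ with parameter $\nu$, then $f = \frac{1}{\alpha\nu} F$ is a projectively self-concordant barrier on $X$ with parameter $\gamma^+ = \frac{\nu^+-2}{\sqrt{\nu^+-1}}$, where $$\alpha = 4 + \frac{3}{\sqrt\nu}, \qquad \vartheta = \frac{1}{\alpha\nu}\left(1 + \frac{\alpha-1}{\left(\frac{\alpha}{\sqrt\alpha+2}-1\right)^2}\right), \qquad \nu^+ = \vartheta\alpha\nu .$$ -/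

import Mathlib

open Topology Filter

noncomputable section

/-- A regular convex set: a closed convex set with non-empty interior which contains no line. -/
structure IsRegularConvexSet {n : ℕ} (X : Set (EuclideanSpace ℝ (Fin n))) : Prop where
  isClosed : IsClosed X
  convex : Convex ℝ X
  interior_nonempty : (interior X).Nonempty
  no_line : ∀ x v : EuclideanSpace ℝ (Fin n), v ≠ 0 → ∃ t : ℝ, x + t • v ∉ X

/-- The first derivative `f'(x)[h]`. -/
def deriv1 {n : ℕ} (f : EuclideanSpace ℝ (Fin n) → ℝ) (x h : EuclideanSpace ℝ (Fin n)) : ℝ :=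
  fderiv ℝ f x h

/-- The second derivative `f''(x)[h,h]`. -/
def deriv2 {n : ℕ} (f : EuclideanSpace ℝ (Fin n) → ℝ) (x h : EuclideanSpace ℝ (Fin n)) : ℝ :=
  iteratedFDeriv ℝ 2 f x ![h, h]

/-- The third derivative `f'''(x)[h,h,h]`. -/
def deriv3 {n : ℕ} (f : EuclideanSpace ℝ (Fin n) → ℝ) (x h : EuclideanSpace ℝ (Fin n)) : ℝ :=
  iteratedFDeriv ℝ 3 f x ![h, h, h]

/-- `lim_{x → ∂X} f(x) = +∞`: as `x` in the interior of `X` tends to any boundary point of `X`,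
`f(x)` tends to `+∞`. -/
def TendsToInftyAtBoundary {n : ℕ} (X : Set (EuclideanSpace ℝ (Fin n)))
    (f : EuclideanSpace ℝ (Fin n) → ℝ) : Prop :=
  ∀ y ∈ frontier X, Tendsto f (𝓝[interior X] y) atTop

/-- `F` is an (affinely) self-concordant barrier on `X` with parameter `ν`. Only the values of `F`
on the (open) interior of `X` enter. -/
structure IsSelfConcordantBarrier {n : ℕ} (X : Set (EuclideanSpace ℝ (Fin n)))
    (F : EuclideanSpace ℝ (Fin n) → ℝ) (ν : ℝ) : Prop where
  param_pos : 0 < ν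
  contDiffOn : ContDiffOn ℝ 3 F (interior X)
  hessian_pos : ∀ x ∈ interior X, ∀ h : EuclideanSpace ℝ (Fin n), h ≠ 0 → 0 < deriv2 F x h
  barrier : TendsToInftyAtBoundary X F
  self_concordant : ∀ x ∈ interior X, ∀ h : EuclideanSpace ℝ (Fin n),
    |deriv3 F x h| ≤ 2 * (deriv2 F x h) ^ (3 / 2 : ℝ)
  gradient_bound : ∀ x ∈ interior X, ∀ h : EuclideanSpace ℝ (Fin n),
    |deriv1 F x h| ≤ √ν * (deriv2 F x h) ^ (1 / 2 : ℝ)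

/-- The affine metric `G(x)[h,h] = f''(x)[h,h] - (f'(x)[h])²`. -/
def affineMetric {n : ℕ} (f : EuclideanSpace ℝ (Fin n) → ℝ)
    (x h : EuclideanSpace ℝ (Fin n)) : ℝ :=
  deriv2 f x h - (deriv1 f x h) ^ 2

/-- The cubic form `C(x)[h,h,h] = f'''(x)[h,h,h] - 6 f''(x)[h,h] f'(x)[h] + 4 (f'(x)[h])³`. -/
def cubicForm {n : ℕ} (f : EuclideanSpace ℝ (Fin n) → ℝ)
    (x h : EuclideanSpace ℝ (Fin n)) : ℝ :=
  deriv3 f x h - 6 * deriv2 f x h * deriv1 f x h + 4 * (deriv1 f x h) ^ 3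

/-- `f` is a projectively self-concordant barrier on `X` with parameter `γ ≥ 0`. Only the values
of `f` on the (open) interior of `X` enter. -/
structure IsProjSelfConcordantBarrier {n : ℕ} (X : Set (EuclideanSpace ℝ (Fin n)))
    (f : EuclideanSpace ℝ (Fin n) → ℝ) (γ : ℝ) : Prop where
  param_nonneg : 0 ≤ γ
  contDiffOn : ContDiffOn ℝ 3 f (interior X)
  metric_pos : ∀ x ∈ interior X, ∀ h : EuclideanSpace ℝ (Fin n), h ≠ 0 → 0 < affineMetric f x h
  barrier : TendsToInftyAtBoundary X f
  cubic_bound : ∀ x ∈ interior X, ∀ h : EuclideanSpace ℝ (Fin n),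
    |cubicForm f x h| ≤ 2 * γ * (affineMetric f x h) ^ (3 / 2 : ℝ)

/-- The Freund–Jarre–Schaible constant `α = 4 + 3/√ν`. -/
def fjsAlpha (ν : ℝ) : ℝ := 4 + 3 / √ν

/-- The Freund–Jarre–Schaible constant
`ϑ = (1 / (αν)) (1 + (α - 1) / (α / (√α + 2) - 1)²)`. -/
def fjsTheta (ν : ℝ) : ℝ :=
  1 / (fjsAlpha ν * ν) *
    (1 + (fjsAlpha ν - 1) / (fjsAlpha ν / (√(fjsAlpha ν) + 2) - 1) ^ 2)

/-- The Freund–Jarre–Schaible constant `ν⁺ = ϑαν`. -/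
def fjsNuPlus (ν : ℝ) : ℝ := fjsTheta ν * fjsAlpha ν * ν

end

open Topology Filter

/-! Both claims are pointwise inequalities along a direction `h`: put g = f'[h], k² = f''[h,h], w² =
k² − g². (i) Solving the cubic form for f''' gives |f'''| ≤ 2 max(±(g³ + 3gw²) + γw³) on the circle
g² + w² = k². A suitable rotation shows that this maximum is at most √ν k³
(`cubic_le_sqrt_affine_param`), and w² ≥ 0 is the gradient bound. (ii) With g, k now taken for F,
|g| ≤ √ν k bounds the metric of F/(αν) below and its cubic form above. Both extremes occur at |g| =
√ν k, and the choice of α makes their ratio exactly 2γ⁺ (`scaled_cubic_le`). -/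

/-- Scaling a barrier by a positive constant preserves divergence at the boundary. -/
theorem TendsToInftyAtBoundary.const_mul {n : ℕ} {X : Set (EuclideanSpace ℝ (Fin n))}
    {f : EuclideanSpace ℝ (Fin n) → ℝ} (hf : TendsToInftyAtBoundary X f) {c : ℝ} (hc : 0 < c) :
    TendsToInftyAtBoundary X (fun x => c * f x) :=
  fun y hy => (hf y hy).const_mul_atTop hc

/-! ### Derivatives under scaling -/

section Scaling

variable {n : ℕ} {f : EuclideanSpace ℝ (Fin n) → ℝ} {x : EuclideanSpace ℝ (Fin n)}

theorem deriv1_const_mul (hf : ContDiffAt ℝ 3 f x) (c : ℝ) (h : EuclideanSpace ℝ (Fin n)) :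
    deriv1 (fun y => c * f y) x h = c * deriv1 f x h := by
  unfold deriv1
  rw [fderiv_const_mul (hf.differentiableAt (by norm_num))]
  rfl

theorem iteratedFDeriv_const_mul_apply {i : ℕ} (hf : ContDiffAt ℝ i f x) (c : ℝ)
    (v : Fin i → EuclideanSpace ℝ (Fin n)) :
    iteratedFDeriv ℝ i (fun y => c * f y) x v = c * iteratedFDeriv ℝ i f x v := by
  have := iteratedFDeriv_const_smul_apply (a := c) hf
  rw [show (fun y => c * f y) = c • f from rfl, this]
  rfl

theorem deriv2_const_mul (hf : ContDiffAt ℝ 3 f x) (c : ℝ) (h : EuclideanSpace ℝ (Fin n)) :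
    deriv2 (fun y => c * f y) x h = c * deriv2 f x h :=
  iteratedFDeriv_const_mul_apply (hf.of_le (by norm_cast)) c _

theorem deriv3_const_mul (hf : ContDiffAt ℝ 3 f x) (c : ℝ) (h : EuclideanSpace ℝ (Fin n)) :
    deriv3 (fun y => c * f y) x h = c * deriv3 f x h :=
  iteratedFDeriv_const_mul_apply (hf.of_le (by norm_cast)) c _

theorem deriv2_zero (f : EuclideanSpace ℝ (Fin n) → ℝ) (x : EuclideanSpace ℝ (Fin n)) :
    deriv2 f x 0 = 0 :=
  (iteratedFDeriv ℝ 2 f x).map_coord_zero 0 rfl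

theorem deriv1_zero (f : EuclideanSpace ℝ (Fin n) → ℝ) (x : EuclideanSpace ℝ (Fin n)) :
    deriv1 f x 0 = 0 :=
  map_zero (fderiv ℝ f x)

theorem affineMetric_zero (f : EuclideanSpace ℝ (Fin n) → ℝ) (x : EuclideanSpace ℝ (Fin n)) :
    affineMetric f x 0 = 0 := by
  simp [affineMetric, deriv1_zero, deriv2_zero]

end Scaling

theorem Real.rpow_three_halves_eq_sqrt_pow {a : ℝ} (ha : 0 ≤ a) :
    a ^ (3 / 2 : ℝ) = √a ^ 3 := by
  rw [Real.sqrt_eq_rpow, ← Real.rpow_natCast, ← Real.rpow_mul ha]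
  norm_num

/-! ### From projective to affine barriers -/

/-- The trigonometric inequality `cos θ cos³ δ + sin θ sin³ δ ≤ cos θ` for `|sin θ| ≤ cos θ`,
written with `(w, g) = k (cos (θ + δ), sin (θ + δ))`. -/
theorem cubic_le_of_sq_add_sq {s c g w k : ℝ} (hsc : s ^ 2 + c ^ 2 = 1) (hs : 0 ≤ s) (hle : s ≤ c)
    (hk : 0 ≤ k) (hgw : g ^ 2 + w ^ 2 = k ^ 2) :
    s * c * (g ^ 3 + 3 * g * w ^ 2) + (c ^ 2 - s ^ 2) * w ^ 3 ≤ c * k ^ 3 := by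
  -- Rotating (w, g) by the angle δ diagonalizes the cubic into two pure cubes.
  have key : s * c * (g ^ 3 + 3 * g * w ^ 2) + (c ^ 2 - s ^ 2) * w ^ 3 =
      c * (c * w + s * g) ^ 3 + s * (g * c - w * s) ^ 3 := by
    obtain hc : c ^ 2 = 1 - s ^ 2 := by linarith
    have h3 : c ^ 3 = c * (1 - s ^ 2) := by rw [← hc]; ring
    have h4 : c ^ 4 = (1 - s ^ 2) ^ 2 := by rw [← hc]; ring
    ring_nf
    rw [h4, h3, hc]
    ring
  have hAB : (c * w + s * g) ^ 2 + (g * c - w * s) ^ 2 = k ^ 2 := by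
    rw [← hgw]; linear_combination (g ^ 2 + w ^ 2) * hsc
  rw [key]
  generalize c * w + s * g = A at *
  generalize g * c - w * s = B at *
  have hA : A ≤ k := abs_le_of_sq_le_sq' (by nlinarith [sq_nonneg B]) hk |>.2
  have hB : B ≤ k := abs_le_of_sq_le_sq' (by nlinarith [sq_nonneg A]) hk |>.2
  have hA3 : A ^ 3 ≤ k * A ^ 2 := by nlinarith [mul_nonneg (sub_nonneg.2 hA) (sq_nonneg A)]
  have hB3 : B ^ 3 ≤ k * B ^ 2 := by nlinarith [mul_nonneg (sub_nonneg.2 hB) (sq_nonneg B)]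
  calc c * A ^ 3 + s * B ^ 3 ≤ c * (k * A ^ 2) + c * (k * B ^ 2) := by
        refine add_le_add (mul_le_mul_of_nonneg_left hA3 (hs.trans hle)) ?_
        exact (mul_le_mul_of_nonneg_left hB3 hs).trans
          (mul_le_mul_of_nonneg_right hle (by positivity))
    _ = c * k ^ 3 := by linear_combination c * k * hAB

/-- The cubic inequality defining the parameter of the affine barrier obtained from a
projective one. -/
theorem cubic_le_sqrt_affine_param {γ g w k : ℝ} (hγ : 0 ≤ γ) (hk : 0 ≤ k)
    (hgw : g ^ 2 + w ^ 2 = k ^ 2) :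
    g ^ 3 + 3 * g * w ^ 2 + γ * w ^ 3 ≤
      √((γ + √(γ ^ 2 + 4)) * √(γ ^ 2 / 4 + 1)) * k ^ 3 := by
  have hhalf : √(γ ^ 2 / 4 + 1) = √(γ ^ 2 + 4) / 2 := by
    rw [show γ ^ 2 / 4 + 1 = (γ ^ 2 + 4) / 2 ^ 2 by ring, Real.sqrt_div (by positivity),
      Real.sqrt_sq (by norm_num)]
  rw [hhalf]
  have hr2 : √(γ ^ 2 + 4) ^ 2 = γ ^ 2 + 4 := Real.sq_sqrt (by positivity)
  have hr : 0 < √(γ ^ 2 + 4) := Real.sqrt_pos.2 (by positivity)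
  set r := √(γ ^ 2 + 4)
  have hν : 0 < (γ + r) * (r / 2) := by positivity
  have hc2 : √((γ + r) * (r / 2)) ^ 2 = (γ + r) * (r / 2) := Real.sq_sqrt hν.le
  have hc : 0 < √((γ + r) * (r / 2)) := Real.sqrt_pos.2 hν
  set m := √((γ + r) * (r / 2))
  -- The angle is sin δ = 1/m, cos δ = m/r, so that r sin δ cos δ = 1 and r cos 2δ = γ. Here `hm`
  -- amounts to sin δ ≤ cos δ; it holds because r ≥ 2.
  have hm : 1 ≤ m ^ 2 / r := by
    rw [le_div_iff₀ hr, hc2]; nlinarith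
  have hsum : (1 / m) ^ 2 + (m / r) ^ 2 = 1 := by
    rw [div_pow, div_pow, hc2]
    field_simp
    linear_combination -hr2
  have hdiff : r * ((m / r) ^ 2 - (1 / m) ^ 2) = γ := by
    rw [div_pow, div_pow, hc2]
    field_simp
    linear_combination hr2
  have h := cubic_le_of_sq_add_sq hsum (by positivity)
    (by rw [div_le_div_iff₀ hc hr]; rw [le_div_iff₀ hr] at hm; linarith) hk hgw
  have h' := mul_le_mul_of_nonneg_left h hr.le
  calc g ^ 3 + 3 * g * w ^ 2 + γ * w ^ 3
      = r * (1 / m * (m / r) * (g ^ 3 + 3 * g * w ^ 2)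
          + ((m / r) ^ 2 - (1 / m) ^ 2) * w ^ 3) := by
        rw [mul_add, ← mul_assoc r (_ - _), hdiff]
        field_simp
    _ ≤ r * (m / r * k ^ 3) := h'
    _ = m * k ^ 3 := by field_simp

theorem IsProjSelfConcordantBarrier.isSelfConcordantBarrier_const_mul {n : ℕ}
    {X : Set (EuclideanSpace ℝ (Fin n))} {f : EuclideanSpace ℝ (Fin n) → ℝ} {γ : ℝ}
    (hf : IsProjSelfConcordantBarrier X f γ) :
    IsSelfConcordantBarrier X
      (fun x => ((γ + √(γ ^ 2 + 4)) * √(γ ^ 2 / 4 + 1)) * f x)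
      ((γ + √(γ ^ 2 + 4)) * √(γ ^ 2 / 4 + 1)) := by
  have hγ := hf.param_nonneg
  have hν : 0 < (γ + √(γ ^ 2 + 4)) * √(γ ^ 2 / 4 + 1) := by positivity
  have hbound (g w k : ℝ) (hk : 0 ≤ k) (hgw : g ^ 2 + w ^ 2 = k ^ 2) :=
    cubic_le_sqrt_affine_param hγ hk hgw
  set ν := (γ + √(γ ^ 2 + 4)) * √(γ ^ 2 / 4 + 1)
  have hC {x} (hx : x ∈ interior X) : ContDiffAt ℝ 3 f x :=
    hf.contDiffOn.contDiffAt (isOpen_interior.mem_nhds hx)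
  have hG {x} (hx : x ∈ interior X) (h) : 0 ≤ affineMetric f x h := by
    obtain rfl | hh := eq_or_ne h 0
    · rw [affineMetric_zero]
    · exact (hf.metric_pos x hx h hh).le
  have hH {x} (hx : x ∈ interior X) (h) : 0 ≤ deriv2 f x h := by
    have := hG hx h
    unfold affineMetric at this
    nlinarith [sq_nonneg (deriv1 f x h)]
  refine ⟨hν, contDiffOn_const.mul hf.contDiffOn, fun x hx h hh => ?_,
    hf.barrier.const_mul hν, fun x hx h => ?_, fun x hx h => ?_⟩
  · rw [deriv2_const_mul (hC hx)]
    have := hf.metric_pos x hx h hh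
    unfold affineMetric at this
    exact mul_pos hν (by nlinarith [sq_nonneg (deriv1 f x h)])
  · rw [deriv2_const_mul (hC hx), deriv3_const_mul (hC hx),
      Real.rpow_three_halves_eq_sqrt_pow (mul_nonneg hν.le (hH hx h)), Real.sqrt_mul hν.le]
    have hcub := hf.cubic_bound x hx h
    rw [Real.rpow_three_halves_eq_sqrt_pow (hG hx h)] at hcub
    have hw := Real.sq_sqrt (hG hx h)
    have hk := Real.sq_sqrt (hH hx h)
    have hk0 := Real.sqrt_nonneg (deriv2 f x h)
    have hν2 := Real.sq_sqrt hν.le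
    generalize √(affineMetric f x h) = w at *
    unfold affineMetric at hw
    unfold cubicForm at hcub
    generalize √(deriv2 f x h) = k at *
    generalize deriv3 f x h = T at *
    generalize deriv1 f x h = g at *
    rw [← hk] at hw hcub
    have h1 := hbound g w k hk0 (by linarith)
    -- The reflection g ↦ −g supplies the lower bound on T.
    have h2 := hbound (-g) w k hk0 (by linarith)
    obtain ⟨hl, hu⟩ := abs_le.1 hcub
    have hgw : w ^ 2 = k ^ 2 - g ^ 2 := hw
    rw [hgw] at h1 h2
    have hT : |T| ≤ 2 * (√ν * k ^ 3) := abs_le.2 ⟨by linarith, by linarith⟩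
    calc |ν * T| = ν * |T| := by rw [abs_mul, abs_of_pos hν]
      _ ≤ ν * (2 * (√ν * k ^ 3)) := mul_le_mul_of_nonneg_left hT hν.le
      _ = 2 * (√ν * k) ^ 3 := by linear_combination (-2 * √ν * k ^ 3) * hν2
  · rw [deriv2_const_mul (hC hx), deriv1_const_mul (hC hx), ← Real.sqrt_eq_rpow,
      Real.sqrt_mul hν.le, ← mul_assoc, Real.mul_self_sqrt hν.le, abs_mul, abs_of_pos hν]
    refine mul_le_mul_of_nonneg_left (Real.abs_le_sqrt ?_) hν.le
    have := hG hx h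
    unfold affineMetric at this
    linarith

/-! ### From affine to projective barriers -/

/-- The parameter `γ⁺` equals `(6 α - 8) / (√(α - 1) (α - 4))`. -/
theorem fjsNuPlus_gamma_eq {ν : ℝ} (hν : 0 < ν) :
    (fjsNuPlus ν - 2) / √(fjsNuPlus ν - 1) =
      (6 * fjsAlpha ν - 8) / (√(fjsAlpha ν - 1) * (fjsAlpha ν - 4)) := by
  have hα : 4 < fjsAlpha ν := by
    unfold fjsAlpha
    linarith [div_pos three_pos (Real.sqrt_pos.2 hν)]
  unfold fjsNuPlus fjsTheta
  generalize fjsAlpha ν = α at *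
  have hα0 : 0 < α := by linarith
  have hs : √α ^ 2 = α := Real.sq_sqrt hα0.le
  have hs2 : 2 < √α := by rw [Real.lt_sqrt (by norm_num)]; linarith
  have hd : 0 < √(α - 1) := Real.sqrt_pos.2 (by linarith)
  have hd2 : √(α - 1) ^ 2 = α - 1 := Real.sq_sqrt (by linarith)
  have hp : 0 < α / (√α + 2) - 1 := by
    rw [sub_pos, lt_div_iff₀ (by linarith)]; nlinarith
  set p := α / (√α + 2) - 1 with hpdef
  have hE : 1 / (α * ν) * (1 + (α - 1) / p ^ 2) * α * ν = 1 + (α - 1) / p ^ 2 := by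
    field_simp
  have hsqrt : √(1 + (α - 1) / p ^ 2 - 1) = √(α - 1) / p := by
    rw [add_sub_cancel_left, Real.sqrt_div (by linarith), Real.sqrt_sq hp.le]
  have hp' : p * (√α + 2) = (√α - 2) * (√α + 1) := by
    rw [hpdef]; field_simp; linear_combination -hs
  rw [hE, hsqrt]
  have h4 : 0 < α - 4 := by linarith
  have hpe : p = (√α - 2) * (√α + 1) / (√α + 2) := by
    rw [eq_div_iff (by linarith), hp']
  -- Since ν⁺ − 1 = (α − 1)/p², one factor p cancels.
  have e1 : (1 + (α - 1) / p ^ 2 - 2) / (√(α - 1) / p) = ((α - 1) / p - p) / √(α - 1) := by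
    field_simp
    ring
  have e2 : (α - 1) / p - p = (6 * α - 8) / (α - 4) := by
    have a1 : √α - 2 ≠ 0 := by linarith
    have a2 : √α + 2 ≠ 0 := by linarith
    have a3 : √α + 1 ≠ 0 := by linarith
    have a4 : √α ^ 2 - 4 ≠ 0 := by rw [hs]; exact h4.ne'
    rw [hpe]
    generalize √α = s at *
    subst hs
    rw [show s ^ 2 - 4 = (s - 2) * (s + 2) by ring]
    field_simp
    ring
  rw [e1, e2, div_div, mul_comm (α - 4)]

/-- The pointwise estimate behind the projective self-concordance of `F / (αν)`, with
`N = √ν`, `k = F''[h,h]^{1/2}`, `g = F'[h]`, `T = F'''[h,h,h]`. -/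
theorem scaled_cubic_le {α N k g T w : ℝ} (hα : 4 < α) (hN : 0 < N) (hNα : N * (α - 4) = 3)
    (hk : 0 ≤ k) (hg : |g| ≤ N * k) (hT : |T| ≤ 2 * k ^ 3) (hw0 : 0 ≤ w)
    (hw : w ^ 2 = k ^ 2 / (α * N ^ 2) - (g / (α * N ^ 2)) ^ 2) :
    |T / (α * N ^ 2) - 6 * (k ^ 2 / (α * N ^ 2)) * (g / (α * N ^ 2)) +
        4 * (g / (α * N ^ 2)) ^ 3| ≤
      2 * ((6 * α - 8) / (√(α - 1) * (α - 4))) * w ^ 3 := by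
  have hd : 0 < √(α - 1) := Real.sqrt_pos.2 (by linarith)
  have hd2 : √(α - 1) ^ 2 = α - 1 := Real.sq_sqrt (by linarith)
  set d := √(α - 1)
  have hα0 : 0 < α := by linarith
  have h4 : 0 < α - 4 := by linarith
  have hg2 : g ^ 2 ≤ (N * k) ^ 2 :=
    sq_le_sq' (by linarith [neg_abs_le g]) (by linarith [le_abs_self g])
  -- For fixed k the metric is smallest at |g| = Nk.
  have hwl : k * d / (α * N) ≤ w := by
    refine abs_le_of_sq_le_sq' ?_ hw0 |>.2
    rw [hw, div_pow, mul_pow, hd2]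
    have : k ^ 2 / (α * N ^ 2) - (g / (α * N ^ 2)) ^ 2 - k ^ 2 * (α - 1) / (α * N) ^ 2 =
        ((N * k) ^ 2 - g ^ 2) / (α * N ^ 2) ^ 2 := by
      field_simp
      ring
    have h' : 0 ≤ ((N * k) ^ 2 - g ^ 2) / (α * N ^ 2) ^ 2 :=
      div_nonneg (by linarith) (by positivity)
    linarith
  have hw3 : (k * d / (α * N)) ^ 3 ≤ w ^ 3 := pow_le_pow_left₀ (by positivity) hwl 3
  have hcoef : 0 ≤ 2 * ((6 * α - 8) / (d * (α - 4))) := by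
    have : 0 < 6 * α - 8 := by linarith
    positivity
  refine le_trans ?_ (mul_le_mul_of_nonneg_left hw3 hcoef)
  have hrhs : 2 * ((6 * α - 8) / (d * (α - 4))) * (k * d / (α * N)) ^ 3 =
      (2 * k ^ 3 * (α * N ^ 2) ^ 2 + 6 * k ^ 2 * (N * k) * (α * N ^ 2) - 4 * (N * k) ^ 3) /
        (α * N ^ 2) ^ 3 := by
    -- Only here does the value α = 4 + 3/√ν matter: it turns α²N + 3α − 2 into (6α − 8)(α − 1)/(α −
    -- 4).
    have hNe : N = 3 / (α - 4) := by rw [eq_div_iff h4.ne']; exact hNα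
    have : 2 * ((6 * α - 8) / (d * (α - 4))) * (k * d / (α * N)) ^ 3 =
      2 * (6 * α - 8) * k ^ 3 * (α - 1) / ((α - 4) * (α * N) ^ 3) := by
      rw [← hd2]; field_simp
    rw [this, div_eq_div_iff (by positivity) (by positivity), hNe]
    field_simp
    ring
  rw [hrhs]
  -- The cubic in y is increasing on |y| ≤ Nk: its difference quotient is at least (6α − 12)(Nk)² ≥
  -- 0.
  have hmono : ∀ y, |y| ≤ N * k → 6 * k ^ 2 * y * (α * N ^ 2) - 4 * y ^ 3 ≤
      6 * k ^ 2 * (N * k) * (α * N ^ 2) - 4 * (N * k) ^ 3 := by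
    intro y hy
    obtain ⟨hy1, hy2⟩ := abs_le.1 hy
    have hf : 0 ≤ 6 * (N * k) ^ 2 * α - 4 * ((N * k) ^ 2 + N * k * y + y ^ 2) := by
      have hy2' : y ^ 2 ≤ (N * k) ^ 2 := sq_le_sq' hy1 hy2
      have : N * k * y ≤ (N * k) ^ 2 := by
        rw [sq]; exact mul_le_mul_of_nonneg_left hy2 (by positivity)
      nlinarith [sq_nonneg (N * k)]
    nlinarith [mul_nonneg (sub_nonneg.2 hy2) hf]
  have hlhs : T / (α * N ^ 2) - 6 * (k ^ 2 / (α * N ^ 2)) * (g / (α * N ^ 2)) +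
      4 * (g / (α * N ^ 2)) ^ 3 =
      (T * (α * N ^ 2) ^ 2 - 6 * k ^ 2 * g * (α * N ^ 2) + 4 * g ^ 3) / (α * N ^ 2) ^ 3 := by
    field_simp
  rw [hlhs, abs_div, abs_of_pos (show 0 < (α * N ^ 2) ^ 3 by positivity)]
  refine div_le_div_of_nonneg_right ?_ (by positivity)
  have h1 := hmono g hg
  have h2 := hmono (-g) (by rwa [abs_neg])
  obtain ⟨hTl, hTu⟩ := abs_le.1 hT
  have h3 := mul_le_mul_of_nonneg_right hTu (show 0 ≤ (α * N ^ 2) ^ 2 by positivity)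
  have h5 := mul_le_mul_of_nonneg_right hTl (show 0 ≤ (α * N ^ 2) ^ 2 by positivity)
  exact abs_le.2 ⟨by linarith, by linarith⟩

theorem IsSelfConcordantBarrier.isProjSelfConcordantBarrier_const_mul {n : ℕ}
    {X : Set (EuclideanSpace ℝ (Fin n))} {F : EuclideanSpace ℝ (Fin n) → ℝ} {ν : ℝ}
    (hF : IsSelfConcordantBarrier X F ν) :
    IsProjSelfConcordantBarrier X
      (fun x => 1 / (fjsAlpha ν * ν) * F x)
      ((fjsNuPlus ν - 2) / √(fjsNuPlus ν - 1)) := by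
  have hν := hF.param_pos
  have hN : 0 < √ν := Real.sqrt_pos.2 hν
  have hN2 : √ν ^ 2 = ν := Real.sq_sqrt hν.le
  rw [fjsNuPlus_gamma_eq hν]
  have hα : 4 < fjsAlpha ν := by
    unfold fjsAlpha
    linarith [div_pos three_pos hN]
  have hNα : √ν * (fjsAlpha ν - 4) = 3 := by unfold fjsAlpha; field_simp; ring
  generalize fjsAlpha ν = α at *
  have hα0 : 0 < α := by linarith
  have ha : 0 < 1 / (α * ν) := by positivity
  have hC {x} (hx : x ∈ interior X) : ContDiffAt ℝ 3 F x :=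
    hF.contDiffOn.contDiffAt (isOpen_interior.mem_nhds hx)
  have hH {x} (hx : x ∈ interior X) (h) : 0 ≤ deriv2 F x h := by
    obtain rfl | hh := eq_or_ne h 0
    · rw [deriv2_zero]
    · exact (hF.hessian_pos x hx h hh).le
  have hpos {x} (hx : x ∈ interior X) (h) (hh : h ≠ 0) :
      0 < affineMetric (fun x => 1 / (α * ν) * F x) x h := by
    unfold affineMetric
    rw [deriv2_const_mul (hC hx), deriv1_const_mul (hC hx)]
    have h1 := hF.gradient_bound x hx h
    rw [← Real.sqrt_eq_rpow, ← Real.sqrt_mul hν.le] at h1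
    have h2 : deriv1 F x h ^ 2 ≤ ν * deriv2 F x h :=
      Real.sq_sqrt (mul_nonneg hν.le (hH hx h)) ▸ sq_le_sq.2 (h1.trans (le_abs_self _))
    have h3 := hF.hessian_pos x hx h hh
    -- Positivity follows from g² ≤ νk² and α > 1.
    have h4 : 1 / (α * ν) * deriv2 F x h - (1 / (α * ν) * deriv1 F x h) ^ 2 =
        (α * (ν * deriv2 F x h) - deriv1 F x h ^ 2) / (α * ν) ^ 2 := by
      field_simp
    rw [h4]
    refine div_pos ?_ (by positivity)
    have h5 : 0 < ν * deriv2 F x h := mul_pos hν h3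
    nlinarith
  refine ⟨?_, contDiffOn_const.mul hF.contDiffOn, fun x hx h hh => hpos hx h hh,
    hF.barrier.const_mul ha, fun x hx h => ?_⟩
  · exact div_nonneg (by linarith) (mul_nonneg (Real.sqrt_nonneg _) (by linarith))
  · have hG : 0 ≤ affineMetric (fun x => 1 / (α * ν) * F x) x h := by
      obtain rfl | hh := eq_or_ne h 0
      · rw [affineMetric_zero]
      · exact (hpos hx h hh).le
    rw [Real.rpow_three_halves_eq_sqrt_pow hG]
    have hw := Real.sq_sqrt hG
    have hw0 := Real.sqrt_nonneg (affineMetric (fun x => 1 / (α * ν) * F x) x h)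
    generalize √(affineMetric (fun x => 1 / (α * ν) * F x) x h) = w at *
    unfold affineMetric at hw
    unfold cubicForm
    rw [deriv2_const_mul (hC hx), deriv1_const_mul (hC hx)] at hw
    rw [deriv2_const_mul (hC hx), deriv1_const_mul (hC hx), deriv3_const_mul (hC hx)]
    have hT := hF.self_concordant x hx h
    have hg := hF.gradient_bound x hx h
    rw [Real.rpow_three_halves_eq_sqrt_pow (hH hx h)] at hT
    rw [← Real.sqrt_eq_rpow] at hg
    have hk := Real.sq_sqrt (hH hx h)
    simp only [one_div_mul_eq_div] at hw ⊢
    rw [← hk, ← hN2] at hw ⊢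
    exact scaled_cubic_le hα hN hNα (Real.sqrt_nonneg _) hg hT hw0 hw

theorem mainTheorem2 {n : ℕ} (X : Set (EuclideanSpace ℝ (Fin n))) (hX : IsRegularConvexSet X) :
    (∀ (f : EuclideanSpace ℝ (Fin n) → ℝ) (γ : ℝ), IsProjSelfConcordantBarrier X f γ →
      IsSelfConcordantBarrier X
        (fun x => ((γ + √(γ ^ 2 + 4)) * √(γ ^ 2 / 4 + 1)) * f x)
        ((γ + √(γ ^ 2 + 4)) * √(γ ^ 2 / 4 + 1))) ∧
    (∀ (F : EuclideanSpace ℝ (Fin n) → ℝ) (ν : ℝ), IsSelfConcordantBarrier X F ν →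
      IsProjSelfConcordantBarrier X
        (fun x => 1 / (fjsAlpha ν * ν) * F x)
        ((fjsNuPlus ν - 2) / √(fjsNuPlus ν - 1))) :=
  ⟨fun _ _ hf => hf.isSelfConcordantBarrier_const_mul,
    fun _ _ hF => hF.isProjSelfConcordantBarrier_const_mul⟩
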